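/- Let $k$ be a positive integer, let $p \ge k$ be a prime, let $q = p^{\ell}$ with $\ell \ge 1$, and let $\mathbb{F}_q$ be the field with $q$ elements. For $x, y \in \mathbb{F}_q^n$ write $\|x-y\|^2 = \sum_{i=1}^n (x_i-y_i)^2 \in \mathbb{F}_q$ for their squared distance. Put $$\gamma = \tfrac{1}{18}(k-1)(2k^2+23k+36)\, q .$$ Then there is a constant $C$, depending only on $k$ and $q$, such that for every $n \ge 1$ and every set $A \subseteq \mathbb{F}_q^n$ that contains no $k$ distinct points $x_1,\dots,x_k$ whose squared distances $\|x_i-x_j\|^2$ $(i \ne j)$ are all equal to one another in $\mathbb{F}_q$, one has $|A| \le C\, n^{\gamma}$. That is, for fixed $k$ and $q$, $|A| = O(n^{\gamma})$. -/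

import Mathlib

/-- The squared distance `‖x - y‖² = ⟨x - y, x - y⟩ = ∑ i, (x i - y i)²` of two vectors of `Fⁿ`,
an element of the field `F`. -/
def sqDist {F : Type*} [Field F] {n : ℕ} (x y : Fin n → F) : F :=
  ∑ i, (x i - y i) ^ 2

/-- All squared distances between two different members of the `k`-tuple `x` are equal in `F`. -/
def AllSqDistEqual {F : Type*} [Field F] {n k : ℕ} (x : Fin k → Fin n → F) : Prop :=
  ∀ i j i' j' : Fin k, i ≠ j → i' ≠ j' → sqDist (x i) (x j) = sqDist (x i') (x j')

/-- `A` contains no `k`-tuple of distinct points whose squared distances are all equal. -/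
def AvoidsEqualSqDist {F : Type*} [Field F] {n : ℕ} (k : ℕ) (A : Finset (Fin n → F)) : Prop :=
  ¬ ∃ x : Fin k → Fin n → F, Function.Injective x ∧ (∀ i, x i ∈ A) ∧ AllSqDistEqual x

/-! Colouring each pair of points by its squared distance uses only `q` colours, so Ramsey's theorem
bounds `|A|` by a constant depending on `k` and `q` alone, not on `n`. As `γ ≥ 0` and `n ≥ 1`, the
factor `n ^ γ` is at least 1 and can only weaken this bound. -/

/-- **Ramsey's theorem** for `r` colours, off-diagonal and for symmetric edge colourings: every
large enough finite set contains, for some colour `κ`, a set of `t κ` points all of whose pairs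
have the colour `κ`. The bound depends only on `r` and `t`. -/
theorem exists_ramsey_bound {r : ℕ} (t : Fin r → ℕ) :
    ∃ N : ℕ, ∀ (V : Type*) (c : V → V → Fin r), (∀ x y, c x y = c y x) →
      ∀ A : Finset V, N ≤ A.card →
        ∃ κ, ∃ S ⊆ A, S.card = t κ ∧ ∀ x ∈ S, ∀ y ∈ S, x ≠ y → c x y = κ := by
  classical
  induction h : ∑ κ, t κ generalizing t with
  | zero =>
    -- A point is needed to supply a colour, since `Fin r` may be empty.
    refine ⟨1, fun V c _ A hA => ?_⟩
    obtain ⟨x, -⟩ := Finset.card_pos.1 hA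
    have ht : t (c x x) = 0 := Finset.sum_eq_zero_iff.1 h _ (Finset.mem_univ _)
    exact ⟨c x x, ∅, Finset.empty_subset _, by simp [ht], by simp⟩
  | succ s ih =>
    by_cases h0 : ∃ κ, t κ = 0
    · obtain ⟨κ, hκ⟩ := h0
      exact ⟨0, fun V c _ A _ => ⟨κ, ∅, Finset.empty_subset _, by simp [hκ], by simp⟩⟩
    push Not at h0
    have hsum (κ : Fin r) : ∑ i, Function.update t κ (t κ - 1) i = s := by
      have hκ : t κ + ∑ i ∈ Finset.univ.erase κ, t i = s + 1 :=
        (Finset.add_sum_erase _ t (Finset.mem_univ κ)).trans h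
      have hpos := h0 κ
      rw [← Finset.add_sum_erase _ _ (Finset.mem_univ κ), Function.update_self,
        Finset.sum_congr rfl fun i hi => Function.update_of_ne (Finset.ne_of_mem_erase hi) _ t]
      change t κ - 1 + ∑ i ∈ Finset.univ.erase κ, t i = s
      omega
    choose N hN using fun κ => ih (Function.update t κ (t κ - 1)) (hsum κ)
    -- The extra 1 pays for a vertex `x`. By pigeonhole some colour `κ` joins `x` to at least `N κ`
    -- points, and `x` extends any `κ`-coloured set found among them.
    refine ⟨∑ κ, N κ + 1, fun V c hc A hA => ?_⟩
    obtain ⟨x, hx⟩ := Finset.card_pos.1 (by omega : 0 < A.card)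
    obtain ⟨κ, -, hκ⟩ : ∃ κ ∈ Finset.univ, N κ ≤ ((A.erase x).filter (c x · = κ)).card := by
      refine Finset.exists_le_of_sum_le ⟨c x x, Finset.mem_univ _⟩ ?_
      rw [← Finset.card_eq_sum_card_fiberwise fun _ _ => Finset.mem_coe.2 (Finset.mem_univ _),
        Finset.card_erase_of_mem hx]
      omega
    obtain ⟨μ, S, hS, hcard, hmono⟩ := hN κ V c hc _ hκ
    have hSA : S ⊆ A.erase x := hS.trans (Finset.filter_subset _ _)
    have hxS : x ∉ S := fun hmem => Finset.notMem_erase x A (hSA hmem)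
    by_cases hμ : μ = κ
    · subst hμ
      have hcx : ∀ y ∈ S, c x y = μ := fun y hy => (Finset.mem_filter.1 (hS hy)).2
      refine ⟨μ, insert x S,
        Finset.insert_subset hx (hSA.trans (Finset.erase_subset _ _)), ?_, ?_⟩
      · rw [Finset.card_insert_of_notMem hxS, hcard, Function.update_self]
        have := h0 μ
        omega
      · intro y hy z hz hyz
        rcases Finset.mem_insert.1 hy with rfl | hyS <;>
          rcases Finset.mem_insert.1 hz with rfl | hzS
        · exact absurd rfl hyz
        · exact hcx z hzS
        · rw [hc]
          exact hcx y hyS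
        · exact hmono y hyS z hzS hyz
    · exact ⟨μ, S, hSA.trans (Finset.erase_subset _ _),
        by rw [hcard, Function.update_of_ne hμ], hmono⟩

theorem sqDist_comm {F : Type*} [Field F] {n : ℕ} (x y : Fin n → F) :
    sqDist x y = sqDist y x :=
  Finset.sum_congr rfl fun _ _ => by ring

/-- Over a field with `q` elements, a set with no `k` points at equal squared distances has
bounded size, by Ramsey's theorem with the squared distance as the colour of a pair. -/
theorem exists_card_le_of_avoidsEqualSqDist (k q : ℕ) :
    ∃ N : ℕ, ∀ (F : Type*) [Field F] [Fintype F], Fintype.card F = q →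
      ∀ (n : ℕ) (A : Finset (Fin n → F)), AvoidsEqualSqDist k A → A.card ≤ N := by
  obtain ⟨N, hN⟩ := exists_ramsey_bound fun _ : Fin q => k
  refine ⟨N, fun F _ _ hF n A hA => ?_⟩
  by_contra! hlt
  let e : F ≃ Fin q := Fintype.equivFinOfCardEq hF
  obtain ⟨κ, S, hSA, hcard, hmono⟩ := hN _ (fun x y => e (sqDist x y))
    (fun x y => by rw [sqDist_comm]) A hlt.le
  let x := (S.equivFinOfCardEq hcard).symm
  have hx {i j : Fin k} (hij : i ≠ j) : sqDist (x i : Fin n → F) (x j) = e.symm κ :=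
    e.eq_symm_apply.2 <| hmono _ (x i).2 _ (x j).2 fun h => hij (x.injective (Subtype.ext h))
  exact hA ⟨fun i => x i, Subtype.val_injective.comp x.injective, fun i => hSA (x i).2,
    fun i j i' j' hij hij' => (hx hij).trans (hx hij').symm⟩

theorem mainTheorem8 (k p ℓ : ℕ) (hk : 1 ≤ k) (hp : p.Prime) (hkp : k ≤ p) (hℓ : 1 ≤ ℓ) :
    ∃ C : ℝ, ∀ (F : Type*) [Field F] [Fintype F], Fintype.card F = p ^ ℓ →
      ∀ n : ℕ, 1 ≤ n → ∀ A : Finset (Fin n → F), AvoidsEqualSqDist k A →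
        (A.card : ℝ) ≤
          C * (n : ℝ) ^ ((1 / 18 : ℝ) * ((k : ℝ) - 1) * (2 * (k : ℝ) ^ 2 + 23 * (k : ℝ) + 36) *
            ((p ^ ℓ : ℕ) : ℝ)) := by
  obtain ⟨N, hN⟩ := exists_card_le_of_avoidsEqualSqDist k (p ^ ℓ)
  refine ⟨N, fun F _ _ hF n hn A hA => ?_⟩
  have hk' : (0 : ℝ) ≤ (k : ℝ) - 1 := sub_nonneg.2 (by exact_mod_cast hk)
  calc (A.card : ℝ) ≤ N := by exact_mod_cast hN F hF n A hA
    _ ≤ N * _ := le_mul_of_one_le_right (Nat.cast_nonneg N)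
      (Real.one_le_rpow (by exact_mod_cast hn) (by positivity))
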